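/- Let $X$ be a compact complex manifold, let $A\subset X$ be an irreducible smooth (closed) subvariety of codimension $r\ge 1$, and let $\pi:Z\to X$ be the blowup of $X$ along $A$. All measures are finite positive Borel measures; a functional on $C^0(Z)$ is called a positive measure if it is integration against such a measure on $Z$. For $\varphi\in C^0(Z)$ let $\pi_*(\varphi):X\to\mathbb{R}$ be the upper semicontinuous function with $\pi_*(\varphi)(x)=\varphi(\pi^{-1}(x))$ for $x\in X\setminus A$ and $\pi_*(\varphi)(x)=\limsup_{y\to x,\ y\in X\setminus A}\varphi(\pi^{-1}(y))$ for $x\in A$. For a measure $\mu$ on $X$ define the functional $\pi^*(\mu)$ on $C^0(Z)$ by $$\pi^*(\mu)(\varphi)=\inf\{\mu(\psi):\ \psi\in C^0(X),\ \psi\ge \pi_*(\varphi)\}.$$ Let $\mu$ be a measure on $X$, and write $\mu=\mu_1+\mu_2$ with positive measures $\mu_1,\mu_2$ such that $\mu_1(A)=0$ and $\mu_2(X\setminus A)=0$. Then: 1. $\pi^*(\mu_1)$ is a positive measure on $Z$. 2. For every $\varphi\in C^0(Z)$, the restriction $\pi_*(\varphi)|_A$ is continuous, and $\pi_*(\varphi)(x)=\sup_{z\in\pi^{-1}(x)}\varphi(z)$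 for all $x\in A$. 3. For every $\varphi\in C^0(Z)$, $\ \pi^*(\mu)(\varphi)=\pi^*(\mu_1)(\varphi)+\mu_2(\pi_*(\varphi)|_A)$. 4. Let $\mathcal{G}$ be the collection of all functionals $\chi$ on $C^0(Z)$ of the form $$\chi(\varphi)=\pi^*(\mu_1)(\varphi)+\mu_2(H(\varphi)),\qquad H(\varphi)(x)=\sum_{i\in I}\tau_i(x)\,\varphi(\gamma_i(x))\quad(x\in A),$$ where $\{U_i\}_{i\in I}$ is a finite open cover of $A$, $\{\tau_i\}$ is a partition of unity on $A$ subordinate to $\{U_i\}$, and $\gamma_i:U_i\to\pi^{-1}(U_i)$ are continuous sections of $\pi$ over $U_i$ (the $i$-th summand being $0$ for $x\notin U_i$). Then $\mathcal{G}$ is nonempty, every $\chi\in\mathcal{G}$ is a positive measure on $Z$, the masses $\chi(1)$, $\chi\in\mathcal{G}$, are uniformly bounded, and $\pi^*(\mu)(\varphi)=\sup_{\chi\in\mathcal{G}}\chi(\varphi)$ for all $\varphi\in C^0(Z)$. -/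

import Mathlib

open Set Filter Topology MeasureTheory
open scoped Manifold ContDiff

/-! ### Complex manifolds, smooth subvarieties and blowups -/

/-- The complex vector space `ℂⁿ`. -/
abbrev Cn (n : ℕ) : Type := EuclideanSpace ℂ (Fin n)

section Geometry

variable (r s : ℕ) {X : Type*} [TopologicalSpace X] [ChartedSpace (Cn (r + s)) X]

/-- A holomorphic chart `e` of the `(r + s)`-dimensional complex manifold `X` is adapted to
`A ⊆ X` (in codimension `r`) if, in its domain, `A` is given by the vanishing of the first `r`
coordinates. -/
def IsAdaptedChart (A : Set X) (e : OpenPartialHomeomorph X (Cn (r + s))) : Prop :=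
  e ∈ IsManifold.maximalAtlas 𝓘(ℂ, Cn (r + s)) ω X ∧
    ∀ x ∈ e.source, x ∈ A ↔ ∀ i : Fin r, e x (Fin.castAdd s i) = 0

/-- `A` is an irreducible smooth subvariety of codimension `r` of the complex manifold `X` of
dimension `r + s`: a closed subset that is a complex submanifold of codimension `r` near each of
its points, and is connected and nonempty (for a smooth analytic set, irreducible means
connected). -/
structure IsSmoothIrreducibleSubvariety (A : Set X) : Prop where
  isClosed : IsClosed A
  isConnected : IsConnected A
  exists_chart : ∀ a ∈ A, ∃ e : OpenPartialHomeomorph X (Cn (r + s)),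
    a ∈ e.source ∧ IsAdaptedChart r s A e

/-- The first `r` coordinates of a point of `ℂ^(r+s)`. -/
def normalPart {r s : ℕ} (y : Cn (r + s)) : Fin r → ℂ := fun i => y (Fin.castAdd s i)

/-- The standard local model over `V ⊆ ℂ^(r+s)` of the blowup along `{y₁ = ⋯ = y_r = 0}`: pairs
`(y, ℓ)` of a point `y ∈ V` and a line `ℓ ∈ ℙ^(r-1)` such that `(y₁, …, y_r) ∈ ℓ`. -/
def blowupModel {r s : ℕ} (V : Set (Cn (r + s))) :
    Set (Cn (r + s) × Projectivization ℂ (Fin r → ℂ)) :=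
  {p | p.1 ∈ V ∧ normalPart p.1 ∈ p.2.submodule}

/-- The standard coordinates of the local model on the part `{ℓ_j ≠ 0}`: a pair `(y, ℓ)` has as
`i`-th coordinate `ℓ_i / ℓ_j` for `i ≤ r`, `i ≠ j`, and `y_i` for `i = j` and for `i > r`.
(The quotient does not depend on the representative of the line `ℓ`.) -/
noncomputable def blowupCoord {r s : ℕ} (j : Fin r)
    (p : Cn (r + s) × Projectivization ℂ (Fin r → ℂ)) : Cn (r + s) :=
  WithLp.toLp 2 (Fin.addCases
    (fun i : Fin r => if i = j then p.1 (Fin.castAdd s j) else p.2.rep i / p.2.rep j)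
    (fun k : Fin s => p.1 (Fin.natAdd r k)))

/-- `π : Z → X` is the blowup of the complex manifold `X` along the complex submanifold `A` of
codimension `r`: a holomorphic map of complex manifolds, biholomorphic over `X \ A`, such that
near every point of `A` there is an adapted chart `e` of `X` over whose domain `π` is isomorphic
to the projection to the first factor of the standard local model
`{(y, ℓ) : (y₁, …, y_r) ∈ ℓ} ⊆ e(domain) × ℙ^(r-1)`. The isomorphism is `z ↦ (e (π z), L z)`;
that it is biholomorphic is expressed by the standard coordinates of the model being holomorphic
charts of `Z`. -/
structure IsBlowup {Z : Type*} [TopologicalSpace Z] [ChartedSpace (Cn (r + s)) Z]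
    (A : Set X) (π : Z → X) : Prop where
  holomorphic : ContMDiff 𝓘(ℂ, Cn (r + s)) 𝓘(ℂ, Cn (r + s)) ω π
  biholomorphic_off_center : ∃ σ : X → Z,
    ContMDiffOn 𝓘(ℂ, Cn (r + s)) 𝓘(ℂ, Cn (r + s)) ω σ Aᶜ ∧
      (∀ x ∈ Aᶜ, π (σ x) = x) ∧ ∀ z ∈ π ⁻¹' Aᶜ, σ (π z) = z
  local_model : ∀ a ∈ A, ∃ (e : OpenPartialHomeomorph X (Cn (r + s)))
    (L : Z → Projectivization ℂ (Fin r → ℂ)),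
      a ∈ e.source ∧ IsAdaptedChart r s A e ∧
      BijOn (fun z => (e (π z), L z)) (π ⁻¹' e.source) (blowupModel e.target) ∧
      ∀ j : Fin r, ∃ κ ∈ IsManifold.maximalAtlas 𝓘(ℂ, Cn (r + s)) ω Z,
        κ.source = {z | π z ∈ e.source ∧ (L z).rep j ≠ 0} ∧
        ∀ z ∈ κ.source, κ z = blowupCoord j (e (π z), L z)

end Geometry

/-! ### Pullback of functionals on continuous functions -/

section Submeasure

variable {X Z : Type*} [TopologicalSpace X] [TopologicalSpace Z]

open Classical in
/-- The canonical upper semicontinuous extension `E(g)` to `X` of a function `g` on `U ⊆ X`: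
`E(g) = g` on `U`, and `E(g)(x) = limsup_{y ∈ U, y → x} g(y)` for `x ∉ U`. Only the values of `g`
on `U` matter. -/
noncomputable def uscExtension (U : Set X) (g : X → ℝ) (x : X) : ℝ :=
  if x ∈ U then g x else limsup g (𝓝[U] x)

/-- The upper semicontinuous pushforward `π_*(φ)` of `φ ∈ C⁰(Z)`, where `π` is a finite covering
over the open dense set `U ⊆ X`: the canonical extension of `x ↦ ∑_{π z = x} φ(z)`, `x ∈ U`. If
`π` is bijective over `U`, this is the extension of `φ ∘ (π|_{π⁻¹(U)})⁻¹`. -/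
noncomputable def pushforwardFun (π : Z → X) (U : Set X) (φ : C(Z, ℝ)) : X → ℝ :=
  uscExtension U fun x => ∑ᶠ z ∈ π ⁻¹' {x}, φ z

/-- The pullback `π^*(m)` of a functional `m` on `C⁰(X)`:
`π^*(m)(φ) = inf {m(ψ) : ψ ∈ C⁰(X), ψ ≥ π_*(φ)}`. -/
noncomputable def pullback (π : Z → X) (U : Set X) (m : C(X, ℝ) → ℝ) (φ : C(Z, ℝ)) : ℝ :=
  sInf (m '' {ψ | ∀ x, pushforwardFun π U φ x ≤ ψ x})

/-- A Borel measure as a functional on continuous functions. -/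
noncomputable def measureFunctional [MeasurableSpace X] (μ : Measure X) (ψ : C(X, ℝ)) : ℝ :=
  ∫ x, ψ x ∂μ

/-- The functional `m` on `C⁰(Z)` is a positive measure: it is integration against a finite Borel
measure. -/
def IsPositiveMeasure [MeasurableSpace Z] (m : C(Z, ℝ) → ℝ) : Prop :=
  ∃ ν : Measure Z, IsFiniteMeasure ν ∧ m = measureFunctional ν

/-- `𝒢` is a nonempty collection of positive measures with uniformly bounded masses whose
pointwise supremum is `m`. -/
def IsSupOfMeasures [MeasurableSpace Z] (m : C(Z, ℝ) → ℝ) (𝒢 : Set (C(Z, ℝ) → ℝ)) : Prop :=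
  𝒢.Nonempty ∧ (∀ χ ∈ 𝒢, IsPositiveMeasure χ) ∧ (∃ C : ℝ, ∀ χ ∈ 𝒢, χ 1 ≤ C) ∧
    ∀ φ : C(Z, ℝ), IsLUB ((fun χ => χ φ) '' 𝒢) (m φ)

/-- A finite open cover `U_i` of `A`, a partition of unity `τ_i` subordinate to it, and continuous
local sections `γ_i : U_i → π⁻¹(U_i)` of `π` (the values of `γ_i` outside `U_i` are irrelevant). -/
structure SectionData (π : Z → X) (A : Set X) where
  m : ℕ
  U : Fin m → Set A
  isOpen : ∀ i, IsOpen (U i)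
  cover : ⋃ i, U i = univ
  τ : PartitionOfUnity (Fin m) A
  subordinate : τ.IsSubordinate U
  γ : Fin m → A → Z
  continuousOn : ∀ i, ContinuousOn (γ i) (U i)
  isSection : ∀ i, ∀ x ∈ U i, π (γ i x) = x

/-- The function `H(φ)(x) = ∑ i, τ_i(x) φ(γ_i(x))` on `A`. -/
noncomputable def SectionData.H {π : Z → X} {A : Set X} (D : SectionData π A) (φ : C(Z, ℝ))
    (x : A) : ℝ :=
  ∑ i, D.τ i x * φ (D.γ i x)

/-- The collection of all functionals `φ ↦ π^*(μ₁)(φ) + μ₂(H(φ))`, where `H` comes from a finite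
open cover of `A`, a partition of unity and local sections. Here `μ₂`, a measure carried by `A`,
is regarded as a measure on `A`. -/
def sectionFamily [MeasurableSpace X] (π : Z → X) (A : Set X) (μ₁ μ₂ : Measure X) :
    Set (C(Z, ℝ) → ℝ) :=
  {χ | ∃ D : SectionData π A, χ = fun φ =>
    pullback π Aᶜ (measureFunctional μ₁) φ + ∫ x : A, D.H φ x ∂(μ₂.comap Subtype.val)}

end Submeasure

/-!
The proof rests on one description of `π_*(φ)`: for every `x`, the value `π_*(φ)(x)` is the maximum
of `φ` over the fibre `π⁻¹(x)` (`isGreatest_pushforwardFun`). Apart from `π` being a continuous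
surjection with a continuous inverse over `X \ A`, only three properties of the blowup are used, all
read off from the charts of the local model:

* `Z` is compact (`IsBlowup.compactSpace`), so that `π` is a closed map. Hence fibrewise maxima
  are upper semicontinuous;
* `π⁻¹(X \ A)` is dense in `Z` (`IsBlowup.dense_preimage_compl`), so that the values of `φ` on a
  fibre over `A` are limits of values of `φ` over `X \ A`;
* `π` has continuous local sections over `A` through every point of `π⁻¹(A)`
  (`IsBlowup.hasLocalSections`), obtained by keeping the line of the local model fixed. Hence
  fibrewise maxima are lower semicontinuous on `A`.

A compact manifold is metrizable, so a bounded upper semicontinuous function is a pointwise limit of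
continuous majorants, and the infimum defining `π^*(μ)(φ)` is `∫ π_*(φ) dμ`
(`pullback_measureFunctional_eq_integral`). The splitting over `μ₁` and `μ₂` is then additivity of
the integral, and `π^*(μ₁)` is the image of `μ₁` under the inverse of `π` over `X \ A`.

An average `H(φ)` over sections is at most `π_*(φ)` on `A`. Conversely, the sections through maximum
points of `φ` in the fibres nearly realize the maximum on neighbourhoods, and finitely many of them,
glued by a partition of unity, give `H(φ) ≥ π_*(φ) - ε` (`exists_sectionData_sub_le_H`).
-/

/-! ### Semicontinuous functions and continuous majorants -/

/-- The sup-convolutions `x ↦ sup_y (f y - n d(x, y))` are `n`-Lipschitz and converge pointwise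
to the upper semicontinuous function `f` from above. -/
theorem UpperSemicontinuous.exists_continuous_majorants_tendsto {X : Type*} [PseudoMetricSpace X]
    {f : X → ℝ} (hf : UpperSemicontinuous f) {C : ℝ} (hC : ∀ x, |f x| ≤ C) :
    ∃ ψ : ℕ → C(X, ℝ), (∀ n x, f x ≤ ψ n x ∧ ψ n x ≤ C) ∧
      ∀ x, Tendsto (fun n => ψ n x) atTop (𝓝 (f x)) := by
  have hbdd : ∀ (n : ℕ) (x : X), BddAbove (range fun y => f y - n * dist x y) := by
    rintro n x
    refine ⟨C, ?_⟩
    rintro _ ⟨y, rfl⟩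
    have := (abs_le.1 (hC y)).2
    have : 0 ≤ (n : ℝ) * dist x y := by positivity
    dsimp only
    linarith
  have hlip : ∀ n : ℕ, LipschitzWith n fun x => ⨆ y, (f y - n * dist x y) := by
    intro n
    refine LipschitzWith.of_le_add_mul _ fun x x' => ?_
    have : Nonempty X := ⟨x⟩
    refine ciSup_le fun y => ?_
    have h1 := le_ciSup (hbdd n x') y
    have h2 : (n : ℝ) * dist x' y ≤ n * (dist x x' + dist x y) := by
      gcongr
      exact dist_triangle_left x' y x
    simp only [NNReal.coe_natCast]
    linarith
  have hle : ∀ (n : ℕ) x, f x ≤ ⨆ y, (f y - n * dist x y) := fun n x => by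
    simpa using le_ciSup (hbdd n x) x
  refine ⟨fun n => ⟨_, (hlip n).continuous⟩, fun n x => ⟨hle n x, ?_⟩, fun x => ?_⟩
  · have : Nonempty X := ⟨x⟩
    refine ciSup_le fun y => ?_
    have := (abs_le.1 (hC y)).2
    have : 0 ≤ (n : ℝ) * dist x y := by positivity
    linarith
  · have : Nonempty X := ⟨x⟩
    refine tendsto_order.2 ⟨fun a ha => Eventually.of_forall fun n => ha.trans_le (hle n x),
      fun a ha => ?_⟩
    obtain ⟨b, hb, hba⟩ := exists_between ha
    obtain ⟨δ, hδ, hball⟩ := Metric.eventually_nhds_iff.1 (hf x b hb)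
    obtain ⟨N, hN⟩ := exists_nat_gt ((C - f x) / δ)
    filter_upwards [eventually_ge_atTop N] with n hn
    refine lt_of_le_of_lt (ciSup_le fun y => ?_) hba
    by_cases hy : dist y x < δ
    · have := hball hy
      have : 0 ≤ (n : ℝ) * dist x y := by positivity
      linarith
    -- far from `x`, the penalty `n d(x, y) ≥ N δ` exceeds the oscillation of `f`
    · have h1 := (abs_le.1 (hC y)).2
      rw [div_lt_iff₀ hδ] at hN
      have h2 : (N : ℝ) * δ ≤ n * dist x y := by
        rw [dist_comm] at hy
        gcongr
        exact not_lt.1 hy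
      linarith

theorem UpperSemicontinuous.integrable_of_abs_le {X : Type*} [TopologicalSpace X]
    [MeasurableSpace X] [OpensMeasurableSpace X] {f : X → ℝ} (hf : UpperSemicontinuous f) {C : ℝ}
    (hC : ∀ x, |f x| ≤ C) (μ : Measure X) [IsFiniteMeasure μ] : Integrable f μ :=
  Integrable.of_bound hf.measurable.aestronglyMeasurable C (ae_of_all _ hC)

/-- The infimum of the integrals of the continuous majorants of a bounded upper semicontinuous
function is its integral. -/
theorem UpperSemicontinuous.isGLB_integral_majorants {X : Type*} [TopologicalSpace X]
    [CompactSpace X] [TopologicalSpace.PseudoMetrizableSpace X] [MeasurableSpace X] [BorelSpace X]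
    {f : X → ℝ} (hf : UpperSemicontinuous f) {C : ℝ} (hC : ∀ x, |f x| ≤ C)
    (μ : Measure X) [IsFiniteMeasure μ] :
    IsGLB (measureFunctional μ '' {ψ | ∀ x, f x ≤ ψ x}) (∫ x, f x ∂μ) := by
  let _ := TopologicalSpace.pseudoMetrizableSpacePseudoMetric X
  obtain ⟨ψ, hψ, hlim⟩ := hf.exists_continuous_majorants_tendsto hC
  refine ⟨?_, fun b hb => ?_⟩
  · rintro _ ⟨g, hg, rfl⟩
    exact integral_mono (hf.integrable_of_abs_le hC μ)
      (BoundedContinuousFunction.integrable μ (BoundedContinuousFunction.mkOfCompact g)) hg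
  · have hconv : Tendsto (fun n => ∫ x, ψ n x ∂μ) atTop (𝓝 (∫ x, f x ∂μ)) := by
      refine tendsto_integral_of_dominated_convergence (fun _ => C)
        (fun n => (ψ n).continuous.measurable.aestronglyMeasurable) (integrable_const C)
        (fun n => ae_of_all _ fun x => ?_) (ae_of_all _ hlim)
      exact abs_le.2 ⟨(abs_le.1 (hC x)).1.trans (hψ n x).1, (hψ n x).2⟩
    exact ge_of_tendsto' hconv fun n => hb ⟨ψ n, fun x => (hψ n x).1, rfl⟩

/-! ### The pushforward of a continuous function as a maximum over fibres -/

section Fibre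

variable {X Z : Type*} [TopologicalSpace Z] {π : Z → X}

theorem abs_le_norm_of_isGreatest [CompactSpace Z] {φ : C(Z, ℝ)} {x : X} {c : ℝ}
    (hc : IsGreatest (φ '' (π ⁻¹' {x})) c) : |c| ≤ ‖φ‖ := by
  obtain ⟨w, -, rfl⟩ := hc.1
  exact φ.norm_coe_le_norm w

variable [TopologicalSpace X] {U : Set X}

theorem pushforwardFun_apply_of_injOn {φ : C(Z, ℝ)} (hinj : InjOn π (π ⁻¹' U)) {z : Z}
    (hz : π z ∈ U) : pushforwardFun π U φ (π z) = φ z := by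
  have : π ⁻¹' {π z} = {z} := by
    ext w
    refine ⟨fun hw => hinj ?_ hz hw, fun hw => by rw [mem_singleton_iff.1 hw]; rfl⟩
    rw [mem_preimage, show π w = π z from hw]
    exact hz
  simp [pushforwardFun, uscExtension, hz, this]

variable [T2Space X] [CompactSpace Z]

/-- If `π` is a continuous surjection from a compact space and is injective over an open set `U`
with dense preimage, then `π_*(φ)(x)` is the maximum of `φ` over the fibre of `x`. Over `x ∉ U`,
the bound from above holds because `π` is closed, and the bound from below because points of the
fibre are limits of points over `U`. -/
theorem isGreatest_pushforwardFun (hπ : Continuous π) (hsurj : Function.Surjective π)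
    (hdense : Dense (π ⁻¹' U)) (hinj : InjOn π (π ⁻¹' U)) (φ : C(Z, ℝ)) (x : X) :
    IsGreatest (φ '' (π ⁻¹' {x})) (pushforwardFun π U φ x) := by
  by_cases hx : x ∈ U
  · obtain ⟨z, rfl⟩ := hsurj x
    rw [pushforwardFun_apply_of_injOn hinj hx]
    refine ⟨⟨z, rfl, rfl⟩, ?_⟩
    rintro _ ⟨w, hw, rfl⟩
    have hw' : π w = π z := hw
    rw [hinj (by rw [mem_preimage, hw']; exact hx) hx hw']
  obtain ⟨z, hz, hmax⟩ := ((isClosed_singleton (x := x)).preimage hπ).isCompact.exists_isMaxOn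
    (hsurj x) φ.continuous.continuousOn
  suffices h : pushforwardFun π U φ x = φ z by
    rw [h]
    exact ⟨⟨z, hz, rfl⟩, by rintro _ ⟨w, hw, rfl⟩; exact hmax hw⟩
  have hz' : π z = x := hz
  set g : X → ℝ := fun y => ∑ᶠ w ∈ π ⁻¹' {y}, φ w with hg
  have hgU : ∀ w, π w ∈ U → g (π w) = φ w := fun w hw => by
    rw [← pushforwardFun_apply_of_injOn (φ := φ) hinj hw]
    simp [pushforwardFun, uscExtension, hw, hg]
  have hup : ∀ c, φ z < c → ∀ᶠ y in 𝓝[U] x, g y < c := by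
    intro c hc
    have hV : IsOpen (π '' {w | c ≤ φ w})ᶜ :=
      (hπ.isClosedMap _ (isClosed_le continuous_const φ.continuous)).isOpen_compl
    have hxV : x ∈ (π '' {w | c ≤ φ w})ᶜ := by
      rintro ⟨w, hw, hwx⟩
      exact absurd (hmax (show w ∈ π ⁻¹' {x} from hwx)) (not_le.2 (hc.trans_le hw))
    filter_upwards [mem_nhdsWithin_of_mem_nhds (hV.mem_nhds hxV), self_mem_nhdsWithin]
      with y hy hyU
    obtain ⟨w, rfl⟩ := hsurj y
    rw [hgU w hyU]
    exact not_le.1 fun h => hy ⟨w, h, rfl⟩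
  have hlow : ∀ c, c < φ z → ∃ᶠ y in 𝓝[U] x, c < g y := by
    intro c hc
    have h1 : ∃ᶠ w in 𝓝[π ⁻¹' U] z, c < g (π w) := by
      have : (𝓝[π ⁻¹' U] z).NeBot := mem_closure_iff_nhdsWithin_neBot.1 (hdense z)
      refine Eventually.frequently ?_
      filter_upwards [mem_nhdsWithin_of_mem_nhds
        ((isOpen_lt continuous_const φ.continuous).mem_nhds hc), self_mem_nhdsWithin] with w hw hwU
      rw [hgU w hwU]
      exact hw
    refine Tendsto.frequently (f := π) ?_ h1
    rw [← hz']
    exact hπ.continuousWithinAt.tendsto_nhdsWithin (mapsTo_preimage π U)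
  have hbdd : IsBoundedUnder (· ≤ ·) (𝓝[U] x) g :=
    ⟨φ z + 1, eventually_map.2 ((hup _ (lt_add_one _)).mono fun _ => le_of_lt)⟩
  have hcob : IsCoboundedUnder (· ≤ ·) (𝓝[U] x) g :=
    IsCoboundedUnder.of_frequently_ge ((hlow _ (sub_one_lt _)).mono fun _ => le_of_lt)
  rw [pushforwardFun, uscExtension, if_neg hx]
  refine le_antisymm (le_of_forall_gt_imp_ge_of_dense fun c hc => ?_)
    (le_of_forall_lt_imp_le_of_dense fun c hc => ?_)
  · exact limsup_le_of_le hcob ((hup c hc).mono fun _ => le_of_lt)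
  · exact le_limsup_of_frequently_le ((hlow c hc).mono fun _ => le_of_lt) hbdd

/-- A function that is fibrewise the maximum of a continuous function on a compact space is upper
semicontinuous. -/
theorem upperSemicontinuous_of_isGreatest (hπ : Continuous π) {φ : C(Z, ℝ)} {f : X → ℝ}
    (hf : ∀ x, IsGreatest (φ '' (π ⁻¹' {x})) (f x)) : UpperSemicontinuous f := by
  intro x c hc
  have hV : IsOpen (π '' {w | c ≤ φ w})ᶜ :=
    (hπ.isClosedMap _ (isClosed_le continuous_const φ.continuous)).isOpen_compl
  have hxV : x ∈ (π '' {w | c ≤ φ w})ᶜ := by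
    rintro ⟨w, hw, hwx⟩
    exact absurd ((hf x).2 ⟨w, hwx, rfl⟩) (not_le.2 (hc.trans_le hw))
  filter_upwards [hV.mem_nhds hxV] with y hy
  obtain ⟨w, hw, hwy⟩ := (hf y).1
  rw [← hwy]
  exact not_le.1 fun h => hy ⟨w, h, hw⟩

/-- `π` has continuous local sections over `A` through every point of `π⁻¹(A)`. A section over
`A ∩ W` is encoded as a function on `X` whose values outside `A ∩ W` are irrelevant. -/
def HasLocalSections (π : Z → X) (A : Set X) : Prop :=
  ∀ z, π z ∈ A → ∃ (W : Set X) (γ : X → Z), IsOpen W ∧ π z ∈ W ∧ ContinuousOn γ (A ∩ W) ∧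
    (∀ y ∈ A ∩ W, π (γ y) = y) ∧ γ (π z) = z

theorem continuousOn_of_isGreatest (hπ : Continuous π) {A : Set X} (hA : HasLocalSections π A)
    {φ : C(Z, ℝ)} {f : X → ℝ} (hf : ∀ x, IsGreatest (φ '' (π ⁻¹' {x})) (f x)) :
    ContinuousOn f A := by
  intro x hx
  refine tendsto_order.2 ⟨fun c hc => ?_, fun c hc =>
    mem_nhdsWithin_of_mem_nhds (upperSemicontinuous_of_isGreatest hπ hf x c hc)⟩
  obtain ⟨z, hz, hzf⟩ := (hf x).1
  obtain rfl : π z = x := hz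
  obtain ⟨W, γ, hW, hzW, hγ, hsec, hγz⟩ := hA z hx
  have h1 : ContinuousWithinAt (fun y => φ (γ y)) (A ∩ W) (π z) :=
    φ.continuous.continuousAt.comp_continuousWithinAt (hγ _ ⟨hx, hzW⟩)
  have h2 : ∀ᶠ y in 𝓝[A ∩ W] (π z), c < φ (γ y) :=
    h1.eventually_const_lt (by simpa only [hγz, hzf] using hc)
  rw [nhdsWithin_inter_of_mem' (mem_nhdsWithin_of_mem_nhds (hW.mem_nhds hzW))] at h2
  filter_upwards [h2, self_mem_nhdsWithin, mem_nhdsWithin_of_mem_nhds (hW.mem_nhds hzW)]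
    with y hy hyA hyW
  exact hy.trans_le ((hf y).2 ⟨γ y, hsec y ⟨hyA, hyW⟩, rfl⟩)

end Fibre

/-! ### Topology of the blowup near the exceptional divisor -/

section Blowup

variable {r s : ℕ}

theorem blowupCoord_castAdd_self (j : Fin r) (p : Cn (r + s) × Projectivization ℂ (Fin r → ℂ)) :
    blowupCoord j p (Fin.castAdd s j) = p.1 (Fin.castAdd s j) := by
  simp [blowupCoord]

theorem blowupCoord_castAdd_of_ne {i j : Fin r} (hij : i ≠ j)
    (p : Cn (r + s) × Projectivization ℂ (Fin r → ℂ)) :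
    blowupCoord j p (Fin.castAdd s i) = p.2.rep i / p.2.rep j := by
  simp [blowupCoord, hij]

theorem blowupCoord_natAdd (j : Fin r) (p : Cn (r + s) × Projectivization ℂ (Fin r → ℂ))
    (k : Fin s) : blowupCoord j p (Fin.natAdd r k) = p.1 (Fin.natAdd r k) := by
  simp [blowupCoord]

theorem continuous_blowupCoord_left (j : Fin r) (ℓ : Projectivization ℂ (Fin r → ℂ)) :
    Continuous fun y : Cn (r + s) => blowupCoord j (y, ℓ) := by
  refine (PiLp.continuous_toLp 2 _).comp (continuous_pi fun i => ?_)
  refine Fin.addCases (fun i => ?_) (fun k => ?_) i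
  · by_cases hij : i = j
    · simpa [hij] using (by fun_prop)
    · simpa [hij] using continuous_const
  · simpa using (by fun_prop)

/-- If `y` lies on the centre, then every `w` with `w_j = 0` that agrees with `y` in the last `s`
coordinates is the coordinate vector of a point `(y, ℓ)` of the local model with `ℓ_j ≠ 0`. -/
theorem exists_blowupCoord_eq (j : Fin r) {y w : Cn (r + s)} (hj : w (Fin.castAdd s j) = 0)
    (hy : ∀ i : Fin r, y (Fin.castAdd s i) = 0)
    (hw : ∀ k : Fin s, w (Fin.natAdd r k) = y (Fin.natAdd r k)) :
    ∃ ℓ : Projectivization ℂ (Fin r → ℂ), ℓ.rep j ≠ 0 ∧ blowupCoord j (y, ℓ) = w := by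
  classical
  set v : Fin r → ℂ := fun i => if i = j then 1 else w (Fin.castAdd s i) with hv
  have hv0 : v ≠ 0 := fun h => by simpa [hv] using congrFun h j
  obtain ⟨a, ha⟩ := Projectivization.exists_smul_eq_mk_rep ℂ v hv0
  have hrep : ∀ i, (Projectivization.mk ℂ v hv0).rep i = (a : ℂ) * v i := fun i => by
    rw [← ha]; rfl
  have hvj : v j = 1 := by simp [hv]
  refine ⟨Projectivization.mk ℂ v hv0, by simp [hrep, hvj], ?_⟩
  ext i
  refine Fin.addCases (fun i => ?_) (fun k => ?_) i
  · by_cases hij : i = j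
    · subst hij
      rw [blowupCoord_castAdd_self, hj]
      exact hy i
    · rw [blowupCoord_castAdd_of_ne hij, hrep, hrep, hvj, mul_one,
        mul_div_cancel_left₀ _ a.ne_zero]
      simp [hv, hij]
  · rw [blowupCoord_natAdd, hw]

theorem mem_blowupModel_of_eq_zero {V : Set (Cn (r + s))} {y : Cn (r + s)} (hyV : y ∈ V)
    (hy : ∀ i : Fin r, y (Fin.castAdd s i) = 0) (ℓ : Projectivization ℂ (Fin r → ℂ)) :
    (y, ℓ) ∈ blowupModel V := by
  refine ⟨hyV, ?_⟩
  have : normalPart y = 0 := funext hy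
  rw [this]
  exact ℓ.submodule.zero_mem

variable {X : Type*} [TopologicalSpace X] [ChartedSpace (Cn (r + s)) X]
  {Z : Type*} [TopologicalSpace Z] [ChartedSpace (Cn (r + s)) Z]
  {A : Set X} {π : Z → X}

theorem IsBlowup.continuous (hπ : IsBlowup r s A π) : Continuous π := hπ.holomorphic.continuous

theorem IsBlowup.injOn (hπ : IsBlowup r s A π) : InjOn π (π ⁻¹' Aᶜ) := by
  obtain ⟨σ, -, -, hσ⟩ := hπ.biholomorphic_off_center
  exact LeftInvOn.injOn hσ

theorem IsBlowup.surjective (hr : 0 < r) (hπ : IsBlowup r s A π) : Function.Surjective π := by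
  intro x
  by_cases hx : x ∈ A
  · obtain ⟨e, L, hxe, he, hbij, -⟩ := hπ.local_model x hx
    have : Nonempty (Fin r) := ⟨⟨0, hr⟩⟩
    obtain ⟨ℓ⟩ : Nonempty (Projectivization ℂ (Fin r → ℂ)) := inferInstance
    obtain ⟨z, hz, hzℓ⟩ := hbij.surjOn
      (mem_blowupModel_of_eq_zero (e.map_source hxe) ((he.2 x hxe).1 hx) ℓ)
    exact ⟨z, e.injOn hz hxe (congrArg Prod.fst hzℓ)⟩
  · obtain ⟨σ, -, hσ, -⟩ := hπ.biholomorphic_off_center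
    exact ⟨σ x, hσ x hx⟩

theorem Projectivization.exists_rep_ne_zero (ℓ : Projectivization ℂ (Fin r → ℂ)) :
    ∃ j, ℓ.rep j ≠ 0 := Function.ne_iff.1 ℓ.rep_nonzero

/-- Moving the `j`-th coordinate of the chart `{ℓ_j ≠ 0}` away from `0` moves a point off the
exceptional divisor. -/
theorem IsBlowup.dense_preimage_compl (hπ : IsBlowup r s A π) : Dense (π ⁻¹' Aᶜ) := by
  intro z
  by_cases hzA : π z ∈ A
  swap
  · exact subset_closure hzA
  obtain ⟨e, L, hze, he, hbij, hκ⟩ := hπ.local_model _ hzA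
  obtain ⟨j, hj⟩ := Projectivization.exists_rep_ne_zero (L z)
  obtain ⟨κ, -, hsource, hcoord⟩ := hκ j
  have hz : z ∈ κ.source := by rw [hsource]; exact ⟨hze, hj⟩
  set w : ℂ → Cn (r + s) := fun t => κ z + t • EuclideanSpace.single (Fin.castAdd s j) (1 : ℂ)
  have hw0 : w 0 = κ z := by simp [w]
  have hwc : Continuous w := by fun_prop
  have hκw : Tendsto (fun t => κ.symm (w t)) (𝓝[≠] 0) (𝓝 z) := by
    have h1 : ContinuousAt (fun t => κ.symm (w t)) 0 := by
      refine ContinuousAt.comp (f := w) ?_ hwc.continuousAt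
      rw [hw0]
      exact κ.continuousAt_symm (κ.map_source hz)
    have h2 := h1.tendsto
    rw [hw0, κ.left_inv hz] at h2
    exact h2.mono_left nhdsWithin_le_nhds
  refine mem_closure_of_tendsto hκw ?_
  have htarget : ∀ᶠ t in 𝓝[≠] (0 : ℂ), w t ∈ κ.target :=
    mem_nhdsWithin_of_mem_nhds (hwc.continuousAt.preimage_mem_nhds
      (κ.open_target.mem_nhds (by rw [hw0]; exact κ.map_source hz)))
  filter_upwards [htarget, self_mem_nhdsWithin] with t ht ht0 hA
  have hs := κ.map_target ht
  have hse : π (κ.symm (w t)) ∈ e.source := by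
    rw [hsource] at hs; exact hs.1
  have h1 := (he.2 _ hse).1 hA j
  have h2 := (he.2 _ hze).1 hzA j
  have h3 := congrArg (fun v : Cn (r + s) => v (Fin.castAdd s j)) (hcoord _ hs)
  have h4 := congrArg (fun v : Cn (r + s) => v (Fin.castAdd s j)) (hcoord _ hz)
  simp only [blowupCoord_castAdd_self, κ.right_inv ht, h1, h2] at h3 h4
  refine ht0 ?_
  simpa [w, h4] using h3

/-- The section keeps the line `L z` of the local model constant. -/
theorem IsBlowup.hasLocalSections (hπ : IsBlowup r s A π) : HasLocalSections π A := by
  intro z hzA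
  obtain ⟨e, L, hze, he, hbij, hκ⟩ := hπ.local_model _ hzA
  obtain ⟨j, hj⟩ := Projectivization.exists_rep_ne_zero (L z)
  obtain ⟨κ, -, hsource, hcoord⟩ := hκ j
  have hsec : ∀ y ∈ A ∩ e.source, blowupCoord j (e y, L z) ∈ κ.target ∧
      π (κ.symm (blowupCoord j (e y, L z))) = y := by
    rintro y ⟨hyA, hye⟩
    obtain ⟨z', hz', hz'y⟩ := hbij.surjOn
      (mem_blowupModel_of_eq_zero (e.map_source hye) ((he.2 y hye).1 hyA) (L z))
    have hL : L z' = L z := congrArg Prod.snd hz'y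
    have hs : z' ∈ κ.source := by rw [hsource]; exact ⟨hz', by rw [hL]; exact hj⟩
    have hc := hcoord z' hs
    rw [show (e (π z'), L z') = (e y, L z) from hz'y] at hc
    rw [← hc, κ.left_inv hs]
    exact ⟨κ.map_source hs, e.injOn hz' hye (congrArg Prod.fst hz'y)⟩
  refine ⟨e.source, fun y => κ.symm (blowupCoord j (e y, L z)), e.open_source, hze, ?_,
    fun y hy => (hsec y hy).2, ?_⟩
  · refine κ.continuousOn_symm.comp ?_ fun y hy => (hsec y hy).1
    exact (continuous_blowupCoord_left j (L z)).comp_continuousOn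
      (e.continuousOn.mono inter_subset_right)
  · have hz : z ∈ κ.source := by rw [hsource]; exact ⟨hze, hj⟩
    simp only [← hcoord z hz, κ.left_inv hz]

/-- Let an ultrafilter on `Z` have image converging to `x`. Off the centre the inverse of `π` is
continuous. If `x` lies on the centre, then the ultrafilter charges, for some `j`, the set where
the `j`-th homogeneous coordinate of the line is the largest in absolute value; there the
coordinates of the `j`-th chart are bounded, so that they converge to a point of the chart. -/
theorem IsBlowup.compactSpace [CompactSpace X] (hA : IsClosed A) (hπ : IsBlowup r s A π) :
    CompactSpace Z := by
  refine ⟨isCompact_iff_ultrafilter_le_nhds.2 fun F _ => ?_⟩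
  obtain ⟨x, -, hx⟩ := isCompact_iff_ultrafilter_le_nhds.1 isCompact_univ (F.map π) (by simp)
  have hFx : Tendsto π F (𝓝 x) := hx
  simp only [mem_univ, true_and]
  by_cases hxA : x ∈ A
  swap
  · obtain ⟨σ, hσ, -, hσπ⟩ := hπ.biholomorphic_off_center
    refine ⟨σ x, ?_⟩
    have hU : Aᶜ ∈ 𝓝 x := hA.isOpen_compl.mem_nhds hxA
    have h1 : Tendsto (fun z => σ (π z)) F (𝓝 (σ x)) :=
      (hσ.continuousOn.continuousAt hU).tendsto.comp hFx
    have h2 : (fun z => σ (π z)) =ᶠ[F] id := by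
      filter_upwards [hFx hU] with z hz using hσπ z hz
    exact (h1.congr' h2)
  obtain ⟨e, L, hxe, he, hbij, hκ⟩ := hπ.local_model _ hxA
  have hFe : ∀ᶠ z in (F : Filter Z), π z ∈ e.source := hFx (e.open_source.mem_nhds hxe)
  obtain ⟨j, hjF⟩ : ∃ j : Fin r, ∀ᶠ z in (F : Filter Z), ∀ i, ‖(L z).rep i‖ ≤ ‖(L z).rep j‖ := by
    have hcover : (⋃ j ∈ (univ : Set (Fin r)), {z | ∀ i, ‖(L z).rep i‖ ≤ ‖(L z).rep j‖}) ∈ F := by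
      refine mem_of_superset univ_mem fun z _ => ?_
      obtain ⟨j₀, -⟩ := Projectivization.exists_rep_ne_zero (L z)
      obtain ⟨j, -, hj⟩ := Finset.univ.exists_max_image (fun i => ‖(L z).rep i‖) ⟨j₀, by simp⟩
      simp only [mem_iUnion]
      exact ⟨j, mem_univ j, fun i => hj i (by simp)⟩
    obtain ⟨j, -, hj⟩ := (Ultrafilter.finite_biUnion_mem_iff finite_univ).1 hcover
    exact ⟨j, hj⟩
  obtain ⟨κ, -, hsource, hcoord⟩ := hκ j
  have hFκ : ∀ᶠ z in (F : Filter Z), z ∈ κ.source := by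
    filter_upwards [hFe, hjF] with z hz hj
    rw [hsource]
    refine ⟨hz, fun h0 => (L z).rep_nonzero (funext fun i => ?_)⟩
    have := hj i
    rw [h0, norm_zero] at this
    exact norm_le_zero_iff.1 this
  have hFex : Tendsto (fun z => e (π z)) F (𝓝 (e x)) := (e.continuousAt hxe).tendsto.comp hFx
  have hcoordlim : ∀ k, Tendsto (fun z => e (π z) k) F (𝓝 (e x k)) := fun k =>
    ((EuclideanSpace.proj (𝕜 := ℂ) k).continuous.tendsto _).comp hFex
  -- each coordinate of the chart converges along `F`
  have hlim : ∀ i : Fin (r + s), ∃ c : ℂ, Tendsto (fun z => κ z i) F (𝓝 c) := by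
    refine Fin.addCases (fun i => ?_) (fun k => ?_)
    · by_cases hij : i = j
      · subst hij
        refine ⟨_, (hcoordlim (Fin.castAdd s i)).congr' ?_⟩
        filter_upwards [hFκ] with z hz
        rw [hcoord z hz, blowupCoord_castAdd_self]
      · have hball : ∀ᶠ z in (F : Filter Z), κ z (Fin.castAdd s i) ∈ Metric.closedBall (0 : ℂ) 1 := by
          filter_upwards [hFκ, hjF] with z hz hj
          rw [hcoord z hz, blowupCoord_castAdd_of_ne hij, mem_closedBall_zero_iff, norm_div]
          exact div_le_one_of_le₀ (hj i) (norm_nonneg _)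
        obtain ⟨c, -, hc⟩ := isCompact_iff_ultrafilter_le_nhds.1
          (isCompact_closedBall (0 : ℂ) 1) (F.map fun z => κ z (Fin.castAdd s i))
          (le_principal_iff.2 hball)
        exact ⟨c, hc⟩
    · refine ⟨_, (hcoordlim (Fin.natAdd r k)).congr' ?_⟩
      filter_upwards [hFκ] with z hz
      rw [hcoord z hz, blowupCoord_natAdd]
  choose c hc using hlim
  set w : Cn (r + s) := WithLp.toLp 2 c with hw
  have hκw : Tendsto κ F (𝓝 w) := by
    have h1 : Tendsto (fun z => WithLp.toLp 2 (fun i => κ z i)) F (𝓝 w) :=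
      ((PiLp.continuous_toLp 2 (fun _ : Fin (r + s) => ℂ)).tendsto c).comp (tendsto_pi_nhds.2 hc)
    exact h1
  have hex := (he.2 x hxe).1 hxA
  have hwj : w (Fin.castAdd s j) = 0 := by
    rw [← hex j]
    refine tendsto_nhds_unique (hc _) ((hcoordlim _).congr' ?_)
    filter_upwards [hFκ] with z hz
    rw [hcoord z hz, blowupCoord_castAdd_self]
  have hwk : ∀ k, w (Fin.natAdd r k) = e x (Fin.natAdd r k) := fun k => by
    refine tendsto_nhds_unique (hc _) ((hcoordlim _).congr' ?_)
    filter_upwards [hFκ] with z hz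
    rw [hcoord z hz, blowupCoord_natAdd]
  obtain ⟨ℓ, hℓj, hℓw⟩ := exists_blowupCoord_eq j hwj hex hwk
  obtain ⟨z₀, hz₀e, hz₀⟩ := hbij.surjOn (mem_blowupModel_of_eq_zero (e.map_source hxe) hex ℓ)
  have hLz₀ : L z₀ = ℓ := congrArg Prod.snd hz₀
  have hz₀κ : z₀ ∈ κ.source := by rw [hsource]; exact ⟨hz₀e, by rw [hLz₀]; exact hℓj⟩
  have hκz₀ : κ z₀ = w := by
    rw [hcoord z₀ hz₀κ, ← hℓw]
    exact congrArg (blowupCoord j) hz₀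
  refine ⟨z₀, ?_⟩
  have h1 : Tendsto (fun z => κ.symm (κ z)) F (𝓝 z₀) := by
    have h2 := κ.continuousAt_symm (κ.map_source hz₀κ)
    rw [ContinuousAt, κ.left_inv hz₀κ, hκz₀] at h2
    exact h2.comp hκw
  refine h1.congr' ?_
  filter_upwards [hFκ] with z hz using κ.left_inv hz

end Blowup

/-! ### The pullback of a measure -/

theorem IsPositiveMeasure.add {Z : Type*} [TopologicalSpace Z] [CompactSpace Z]
    [MeasurableSpace Z] [BorelSpace Z] {m m' : C(Z, ℝ) → ℝ} (h : IsPositiveMeasure m)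
    (h' : IsPositiveMeasure m') : IsPositiveMeasure fun φ => m φ + m' φ := by
  obtain ⟨ν, hν, rfl⟩ := h
  obtain ⟨ν', hν', rfl⟩ := h'
  refine ⟨ν + ν', inferInstance, funext fun φ => ?_⟩
  have hint : ∀ (ρ : Measure Z) [IsFiniteMeasure ρ], Integrable φ ρ := fun ρ _ =>
    BoundedContinuousFunction.integrable ρ (BoundedContinuousFunction.mkOfCompact φ)
  exact (integral_add_measure (hint ν) (hint ν')).symm

section Pullback

variable {X Z : Type*} [TopologicalSpace X] [T2Space X] [MeasurableSpace X] [BorelSpace X]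
  [TopologicalSpace Z] [CompactSpace Z] {π : Z → X} {U : Set X}

theorem integrable_pushforwardFun (hπ : Continuous π) (hsurj : Function.Surjective π)
    (hdense : Dense (π ⁻¹' U)) (hinj : InjOn π (π ⁻¹' U)) (μ : Measure X) [IsFiniteMeasure μ]
    (φ : C(Z, ℝ)) : Integrable (pushforwardFun π U φ) μ :=
  have hf := isGreatest_pushforwardFun hπ hsurj hdense hinj φ
  (upperSemicontinuous_of_isGreatest hπ hf).integrable_of_abs_le
    (fun x => abs_le_norm_of_isGreatest (hf x)) μ

variable [CompactSpace X] [TopologicalSpace.PseudoMetrizableSpace X]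

theorem pullback_measureFunctional_eq_integral (hπ : Continuous π)
    (hsurj : Function.Surjective π) (hdense : Dense (π ⁻¹' U)) (hinj : InjOn π (π ⁻¹' U))
    (μ : Measure X) [IsFiniteMeasure μ] (φ : C(Z, ℝ)) :
    pullback π U (measureFunctional μ) φ = ∫ x, pushforwardFun π U φ x ∂μ := by
  have hf := isGreatest_pushforwardFun hπ hsurj hdense hinj φ
  have hC := fun x => abs_le_norm_of_isGreatest (hf x)
  refine ((upperSemicontinuous_of_isGreatest hπ hf).isGLB_integral_majorants hC μ).csInf_eq ?_
  exact ⟨_, ContinuousMap.const X ‖φ‖, fun x => (le_abs_self _).trans (hC x), rfl⟩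

/-- The pullback of a measure carried by `U` is its image under the inverse of `π` over `U`. -/
theorem isPositiveMeasure_pullback [MeasurableSpace Z] [BorelSpace Z] (hπ : Continuous π)
    (hsurj : Function.Surjective π) (hU : IsOpen U) (hdense : Dense (π ⁻¹' U))
    (hinj : InjOn π (π ⁻¹' U)) {σ : X → Z} (hσ : ContinuousOn σ U) (hπσ : ∀ x ∈ U, π (σ x) = x)
    (μ : Measure X) [IsFiniteMeasure μ] (hμ : μ Uᶜ = 0) :
    IsPositiveMeasure (pullback π U (measureFunctional μ)) := by
  refine ⟨(μ.restrict U).map σ, inferInstance, funext fun φ => ?_⟩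
  have hσm : AEMeasurable σ (μ.restrict U) := hσ.aemeasurable hU.measurableSet
  rw [pullback_measureFunctional_eq_integral hπ hsurj hdense hinj, measureFunctional,
    integral_map hσm φ.continuous.measurable.aestronglyMeasurable,
    ← setIntegral_eq_integral_of_ae_compl_eq_zero (s := U)
      ((measure_eq_zero_iff_ae_notMem.1 hμ).mono fun _ hx hxU => absurd hxU hx)]
  refine setIntegral_congr_fun hU.measurableSet fun x hx => ?_
  have h := pushforwardFun_apply_of_injOn (φ := φ) hinj (z := σ x) (by rw [hπσ x hx]; exact hx)
  rwa [hπσ x hx] at h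

end Pullback

/-! ### Averages over local sections -/

namespace SectionData

variable {X Z : Type*} [TopologicalSpace X] [TopologicalSpace Z] {π : Z → X} {A : Set X}

theorem continuous_term (D : SectionData π A) (φ : C(Z, ℝ)) (i : Fin D.m) :
    Continuous fun x => D.τ i x * φ (D.γ i x) :=
  D.τ.continuous_smul (g := fun x => φ (D.γ i x)) fun _ hx =>
    φ.continuous.continuousAt.comp ((D.continuousOn i).continuousAt
      ((D.isOpen i).mem_nhds (D.subordinate i hx)))

theorem continuous_H (D : SectionData π A) (φ : C(Z, ℝ)) : Continuous (D.H φ) :=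
  continuous_finsetSum _ fun i _ => D.continuous_term φ i

theorem mem_U_of_τ_ne_zero (D : SectionData π A) {i : Fin D.m} {x : A} (h : D.τ i x ≠ 0) :
    x ∈ D.U i :=
  D.subordinate i (subset_tsupport _ h)

theorem sum_τ (D : SectionData π A) (x : A) : ∑ i, D.τ i x = 1 := by
  rw [← finsum_eq_sum_of_fintype]
  exact D.τ.sum_eq_one (mem_univ x)

theorem H_one (D : SectionData π A) (x : A) : D.H 1 x = 1 := by
  simp [H, D.sum_τ]

theorem le_H (D : SectionData π A) {φ : C(Z, ℝ)} {x : A} {c : ℝ}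
    (h : ∀ i, x ∈ D.U i → c ≤ φ (D.γ i x)) : c ≤ D.H φ x := by
  rw [← one_mul c, ← D.sum_τ x, Finset.sum_mul]
  refine Finset.sum_le_sum fun i _ => ?_
  by_cases hi : D.τ i x = 0
  · simp [hi]
  · exact mul_le_mul_of_nonneg_left (h i (D.mem_U_of_τ_ne_zero hi)) (D.τ.nonneg i x)

theorem H_le (D : SectionData π A) {φ : C(Z, ℝ)} {x : A} {c : ℝ}
    (h : c ∈ upperBounds (φ '' (π ⁻¹' {(x : X)}))) : D.H φ x ≤ c := by
  rw [← one_mul c, ← D.sum_τ x, Finset.sum_mul]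
  refine Finset.sum_le_sum fun i _ => ?_
  by_cases hi : D.τ i x = 0
  · simp [hi]
  · exact mul_le_mul_of_nonneg_left
      (h ⟨_, D.isSection i x (D.mem_U_of_τ_ne_zero hi), rfl⟩) (D.τ.nonneg i x)

/-- `φ ↦ ∫ H(φ) dν` is integration against the sum of the images of the measures `τ_i ν` under
the sections `γ_i`. -/
theorem isPositiveMeasure_integral_H [CompactSpace Z] [MeasurableSpace X] [BorelSpace X]
    [MeasurableSpace Z] [BorelSpace Z] (D : SectionData π A) (ν : Measure A)
    [IsFiniteMeasure ν] : IsPositiveMeasure fun φ => ∫ x, D.H φ x ∂ν := by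
  set ρ : Fin D.m → Measure A := fun i =>
    (ν.restrict (D.U i)).withDensity fun x => ENNReal.ofReal (D.τ i x)
  have hτm : ∀ i, Measurable fun x => ENNReal.ofReal (D.τ i x) := fun i =>
    (D.τ i).continuous.measurable.ennreal_ofReal
  have hρ : ∀ i, IsFiniteMeasure (ρ i) := fun i =>
    isFiniteMeasure_withDensity_ofReal
      (Integrable.of_bound (D.τ i).continuous.measurable.aestronglyMeasurable 1
        (ae_of_all _ fun x => by
          rw [Real.norm_of_nonneg (D.τ.nonneg i x)]; exact D.τ.le_one i x)).2
  have hγ : ∀ i, AEMeasurable (D.γ i) (ρ i) := fun i =>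
    ((D.continuousOn i).aemeasurable (D.isOpen i).measurableSet).mono_ac
      (withDensity_absolutelyContinuous _ _)
  refine ⟨Measure.sum fun i => (ρ i).map (D.γ i), ?_, funext fun φ => ?_⟩
  · rw [Measure.sum_fintype]
    infer_instance
  have hterm : ∀ i, ∫ x, D.τ i x * φ (D.γ i x) ∂ν = ∫ z, φ z ∂((ρ i).map (D.γ i)) := by
    intro i
    rw [integral_map (hγ i) φ.continuous.measurable.aestronglyMeasurable,
      integral_withDensity_eq_integral_toReal_smul (hτm i)
        (ae_of_all _ fun _ => ENNReal.ofReal_lt_top),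
      ← setIntegral_eq_integral_of_forall_compl_eq_zero (s := D.U i)]
    · simp only [ENNReal.toReal_ofReal (D.τ.nonneg i _), smul_eq_mul]
    · intro x hx
      rw [not_imp_comm.1 D.mem_U_of_τ_ne_zero hx, zero_mul]
  have hint : ∀ i, Integrable (fun x => D.τ i x * φ (D.γ i x)) ν := fun i => by
    refine Integrable.of_bound (D.continuous_term φ i).measurable.aestronglyMeasurable ‖φ‖
      (ae_of_all _ fun x => ?_)
    rw [norm_mul, Real.norm_of_nonneg (D.τ.nonneg i x)]
    exact (mul_le_mul (D.τ.le_one i x) (φ.norm_coe_le_norm _) (norm_nonneg _) zero_le_one).trans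
      (one_mul _).le
  simp only [H, measureFunctional]
  rw [integral_finsetSum _ fun i _ => hint i, Measure.sum_fintype,
    integral_finsetSum_measure (f := φ) fun i _ =>
      BoundedContinuousFunction.integrable _ (BoundedContinuousFunction.mkOfCompact φ)]
  exact Finset.sum_congr rfl fun i _ => hterm i

end SectionData

/-- Near each point of `A`, a section through a maximum point of `φ` in the fibre has values of `φ`
above `f - ε`, because `f` is continuous on `A`; finitely many of these sections suffice. -/
theorem exists_sectionData_sub_le_H {X Z : Type*} [TopologicalSpace X] [T2Space X]
    [TopologicalSpace Z] [CompactSpace Z] {π : Z → X} {A : Set X} (hA : IsCompact A)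
    (hπ : Continuous π) (hsec : HasLocalSections π A) {φ : C(Z, ℝ)} {f : X → ℝ}
    (hf : ∀ x, IsGreatest (φ '' (π ⁻¹' {x})) (f x)) {ε : ℝ} (hε : 0 < ε) :
    ∃ D : SectionData π A, ∀ x : A, f x - ε ≤ D.H φ x := by
  have hAc : CompactSpace A := isCompact_iff_compactSpace.1 hA
  have hfc : Continuous fun x : A => f x :=
    (continuousOn_of_isGreatest hπ hsec hf).domRestrict
  have hloc : ∀ a : A, ∃ (V : Set A) (γ : A → Z), IsOpen V ∧ a ∈ V ∧ ContinuousOn γ V ∧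
      (∀ x ∈ V, π (γ x) = x) ∧ ∀ x ∈ V, f x - ε ≤ φ (γ x) := by
    rintro ⟨a, ha⟩
    obtain ⟨z, hz, hzf⟩ := (hf a).1
    obtain rfl : π z = a := hz
    obtain ⟨W, γ, hW, hzW, hγ, hγs, hγz⟩ := hsec z ha
    have hγ' : ContinuousOn (fun x : A => γ x) (Subtype.val ⁻¹' W) :=
      hγ.comp continuous_subtype_val.continuousOn fun x hx => ⟨x.2, hx⟩
    have hW' : IsOpen ((Subtype.val : A → X) ⁻¹' W) := hW.preimage continuous_subtype_val
    refine ⟨Subtype.val ⁻¹' W ∩ (fun x : A => f x - ε - φ (γ x)) ⁻¹' Iio 0,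
      fun x => γ x, ?_, ⟨hzW, ?_⟩, hγ'.mono inter_subset_left, fun x hx => hγs x ⟨x.2, hx.1⟩,
      fun x hx => ?_⟩
    · exact ((hfc.sub continuous_const).continuousOn.sub
        (φ.continuous.comp_continuousOn hγ')).isOpen_inter_preimage hW' isOpen_Iio
    · simp only [mem_preimage, mem_Iio, hγz, hzf]
      linarith
    · have : f x - ε - φ (γ x) < 0 := hx.2
      linarith
  choose V γ hVo hV hγ hγs hγε using hloc
  obtain ⟨t, ht⟩ := isCompact_univ.elim_finite_subcover V hVo fun a _ => mem_iUnion.2 ⟨a, hV a⟩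
  let g : Fin t.card → A := fun i => (t.equivFin.symm i : A)
  have hcover : (univ : Set A) ⊆ ⋃ i, V (g i) := by
    intro x hx
    obtain ⟨a, ha, hxa⟩ := mem_iUnion₂.1 (ht hx)
    exact mem_iUnion.2 ⟨t.equivFin ⟨a, ha⟩, by simpa [g] using hxa⟩
  obtain ⟨τ, hτ⟩ := PartitionOfUnity.exists_isSubordinate isClosed_univ (fun i => V (g i))
    (fun i => hVo _) hcover
  let D : SectionData π A :=
    { m := t.card
      U := fun i => V (g i)
      isOpen := fun i => hVo _
      cover := univ_subset_iff.1 hcover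
      τ := τ
      subordinate := hτ
      γ := fun i => γ (g i)
      continuousOn := fun i => hγ _
      isSection := fun i => hγs _ }
  exact ⟨D, fun x => D.le_H fun i hi => hγε (g i) x hi⟩

/-! ### The pullback under a blowup -/

theorem mainTheorem4 {r s : ℕ} (hr : 0 < r)
    {X : Type*} [TopologicalSpace X] [T2Space X] [CompactSpace X]
    [ChartedSpace (Cn (r + s)) X] [IsManifold 𝓘(ℂ, Cn (r + s)) ω X]
    [MeasurableSpace X] [BorelSpace X]
    {Z : Type*} [TopologicalSpace Z] [T2Space Z]
    [ChartedSpace (Cn (r + s)) Z] [IsManifold 𝓘(ℂ, Cn (r + s)) ω Z]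
    [MeasurableSpace Z] [BorelSpace Z]
    (A : Set X) (hA : IsSmoothIrreducibleSubvariety r s A)
    (π : Z → X) (hπ : IsBlowup r s A π)
    (μ μ₁ μ₂ : Measure X) [IsFiniteMeasure μ] (hμ : μ = μ₁ + μ₂)
    (hμ₁ : μ₁ A = 0) (hμ₂ : μ₂ Aᶜ = 0) :
    IsPositiveMeasure (pullback π Aᶜ (measureFunctional μ₁)) ∧
    (∀ φ : C(Z, ℝ), ContinuousOn (pushforwardFun π Aᶜ φ) A ∧
      ∀ x ∈ A, IsLUB (φ '' (π ⁻¹' {x})) (pushforwardFun π Aᶜ φ x)) ∧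
    (∀ φ : C(Z, ℝ), pullback π Aᶜ (measureFunctional μ) φ =
      pullback π Aᶜ (measureFunctional μ₁) φ +
        ∫ x : A, pushforwardFun π Aᶜ φ x ∂(μ₂.comap Subtype.val)) ∧
    IsSupOfMeasures (pullback π Aᶜ (measureFunctional μ)) (sectionFamily π A μ₁ μ₂) := by
  have hAc := hA.isClosed
  have hAm : MeasurableSet A := hAc.measurableSet
  have hZ : CompactSpace Z := hπ.compactSpace hAc
  have : SecondCountableTopology X :=
    ChartedSpace.secondCountable_of_sigmaCompact (Cn (r + s)) X
  have : IsFiniteMeasure μ₁ := isFiniteMeasure_of_le μ (hμ ▸ Measure.le_add_right le_rfl)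
  have : IsFiniteMeasure μ₂ := isFiniteMeasure_of_le μ (hμ ▸ Measure.le_add_left le_rfl)
  set ν : Measure A := μ₂.comap Subtype.val with hν
  have hc := hπ.continuous
  have hsurj := hπ.surjective hr
  have hd := hπ.dense_preimage_compl
  have hinj := hπ.injOn
  have hsec := hπ.hasLocalSections
  have hf := isGreatest_pushforwardFun hc hsurj hd hinj
  have hcont : ∀ φ : C(Z, ℝ), ContinuousOn (pushforwardFun π Aᶜ φ) A := fun φ =>
    continuousOn_of_isGreatest hc hsec (hf φ)
  have h1 : IsPositiveMeasure (pullback π Aᶜ (measureFunctional μ₁)) := by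
    obtain ⟨σ, hσ, hπσ, -⟩ := hπ.biholomorphic_off_center
    exact isPositiveMeasure_pullback hc hsurj hAc.isOpen_compl hd hinj hσ.continuousOn hπσ μ₁
      (by rwa [compl_compl])
  have h3 : ∀ φ : C(Z, ℝ), pullback π Aᶜ (measureFunctional μ) φ =
      pullback π Aᶜ (measureFunctional μ₁) φ + ∫ x : A, pushforwardFun π Aᶜ φ x ∂ν := by
    intro φ
    have hint : ∀ (ρ : Measure X) [IsFiniteMeasure ρ], Integrable (pushforwardFun π Aᶜ φ) ρ :=
      fun ρ _ => integrable_pushforwardFun hc hsurj hd hinj ρ φ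
    rw [pullback_measureFunctional_eq_integral hc hsurj hd hinj,
      pullback_measureFunctional_eq_integral hc hsurj hd hinj, hν,
      integral_subtype_comap hAm (pushforwardFun π Aᶜ φ),
      setIntegral_eq_integral_of_ae_compl_eq_zero
        ((measure_eq_zero_iff_ae_notMem.1 hμ₂).mono fun _ hx hxA => absurd hxA hx), hμ,
      integral_add_measure (hint μ₁) (hint μ₂)]
  have hfint : ∀ φ : C(Z, ℝ), Integrable (fun x : A => pushforwardFun π Aᶜ φ x) ν := fun φ =>
    Integrable.of_bound (hcont φ).domRestrict.measurable.aestronglyMeasurable ‖φ‖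
      (ae_of_all _ fun x => abs_le_norm_of_isGreatest (hf φ x))
  have : CompactSpace A := isCompact_iff_compactSpace.1 hAc.isCompact
  have hHint : ∀ (D : SectionData π A) (φ : C(Z, ℝ)), Integrable (D.H φ) ν := fun D φ =>
    BoundedContinuousFunction.integrable ν
      (BoundedContinuousFunction.mkOfCompact ⟨D.H φ, D.continuous_H φ⟩)
  have hexists : ∀ (φ : C(Z, ℝ)) {ε : ℝ}, 0 < ε →
      ∃ D : SectionData π A, ∀ x : A, pushforwardFun π Aᶜ φ x - ε ≤ D.H φ x := fun φ _ hε =>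
    exists_sectionData_sub_le_H hAc.isCompact hc hsec (hf φ) hε
  refine ⟨h1, fun φ => ⟨hcont φ, fun x _ => (hf φ x).isLUB⟩, h3, ?_, ?_, ?_, fun φ => ⟨?_, ?_⟩⟩
  · obtain ⟨D, -⟩ := hexists 0 one_pos
    exact ⟨_, D, rfl⟩
  · rintro _ ⟨D, rfl⟩
    exact h1.add (D.isPositiveMeasure_integral_H ν)
  · refine ⟨pullback π Aᶜ (measureFunctional μ₁) 1 + ∫ _ : A, (1 : ℝ) ∂ν, ?_⟩
    rintro _ ⟨D, rfl⟩
    simp only [D.H_one]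
    exact le_rfl
  · rintro _ ⟨_, ⟨D, rfl⟩, rfl⟩
    simp only [h3]
    exact add_le_add le_rfl (integral_mono (hHint D φ) (hfint φ) fun x => D.H_le (hf φ x).2)
  · intro b hb
    refine le_of_forall_pos_le_add fun δ hδ => ?_
    have hM : 0 ≤ ν.real univ := measureReal_nonneg
    -- an error `δ / (ν(A) + 1)` in the integrand costs at most `δ` in the integral
    obtain ⟨D, hD⟩ := hexists φ (ε := δ / (ν.real univ + 1)) (by positivity)
    have h4 : pullback π Aᶜ (measureFunctional μ₁) φ + ∫ x : A, D.H φ x ∂ν ≤ b :=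
      hb ⟨_, ⟨D, rfl⟩, rfl⟩
    have h5 := integral_mono ((hfint φ).sub (integrable_const _)) (hHint D φ) hD
    simp only [Pi.sub_apply] at h5
    rw [integral_sub (hfint φ) (integrable_const _), integral_const, smul_eq_mul] at h5
    have h6 : ν.real univ * (δ / (ν.real univ + 1)) ≤ δ := by
      rw [mul_div_assoc', div_le_iff₀ (by positivity)]
      nlinarith
    rw [h3]
    linarith
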